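/- A paratopological group is a group with a topology for which multiplication is jointly continuous; regular includes $T_1$. A paratopological group $G$ is simply $sm$-factorizable if for every co-zero set $U\subseteq G$ there is a continuous homomorphism $\pi$ of $G$ onto a separable metrizable paratopological group such that $\pi^{-1}(\pi(U))=U$; it is strongly submetrizable if it admits a coarser separable metrizable paratopological group topology. For a space $X$, $\upsilon X$ denotes the Hewitt–Nachbin realcompactification, i.e. the closure of the image of $X$ under $x\mapsto (f(x))_{f\in C(X,\mathbb R)}$ in $\mathbb R^{C(X,\mathbb R)}$, with the canonical map $X\to\upsilon X$. The $G_\delta$-closure of a subset $Y$ of a space $X$ is the set of all $x\in X$ such that every $G_\delta$-set in $X$ containing $x$ meets $Y$. Theorem. Let $G$ be a regular simply $sm$-factorizable paratopological group. Then the space $\upsilon G$ is realcompact, the canonical map $G\to\upsilon G$ is a homeomorphism of $G$ onto a dense $C$-embedded subspace of $\upsilon G$ (so we regard $G$ as a subspace of $\upsilon G$), and there is a unique group structure on $\upsilon G$ that makes it a paratopological group containing $G$ as a (dense) subgroup. With this structure, $\upsilon G$ is again simply $sm$-factorizable. Moreover, there are a family $(H_\alpha)_{\alpha\in A}$ of regular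 strongly submetrizable paratopological groups and a homomorphism $j\colon\upsilon G\to\prod_{\alpha\in A}H_\alpha$ that is a topological embedding, such that $G$ is mapped onto each $H_\alpha$ by the $\alpha$-th coordinate of $j$ and $j(\upsilon G)$ is the $G_\delta$-closure of $j(G)$ in $\prod_{\alpha\in A}H_\alpha$. -/

import Mathlib

open Topology

universe u

/-- The canonical map `x ↦ (f x)_f` of a space `X` to the product `ℝ ^ C(X, ℝ)`. -/
def realEval (X : Type u) [TopologicalSpace X] (x : X) : C(X, ℝ) → ℝ := fun f => f x

/-- The Hewitt–Nachbin realcompactification `υX`: the closure of the canonical image of `X`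
in `ℝ ^ C(X, ℝ)`, with the subspace topology. -/
def HewittNachbin (X : Type u) [TopologicalSpace X] : Type u :=
  {p : C(X, ℝ) → ℝ // p ∈ closure (Set.range (realEval X))}

instance HewittNachbin.instTopologicalSpace (X : Type u) [TopologicalSpace X] :
    TopologicalSpace (HewittNachbin X) :=
  inferInstanceAs (TopologicalSpace {p : C(X, ℝ) → ℝ // p ∈ closure (Set.range (realEval X))})

/-- The canonical map `X → υX`. -/
def HewittNachbin.unit (X : Type u) [TopologicalSpace X] (x : X) : HewittNachbin X :=
  ⟨realEval X x, subset_closure (Set.mem_range_self x)⟩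

/-- A space is realcompact if it is homeomorphic to a closed subspace of a power of `ℝ`. -/
def IsRealcompact (X : Type u) [TopologicalSpace X] : Prop :=
  ∃ (ι : Type u) (e : X → ι → ℝ), IsClosedEmbedding e

/-- `i : X → Y` exhibits `Y` as the realcompactification of `X`: `Y` is realcompact and `i` is a
homeomorphism of `X` onto a dense `C`-embedded subspace of `Y`. -/
structure IsRealcompactification {X Y : Type u} [TopologicalSpace X] [TopologicalSpace Y]
    (i : X → Y) : Prop where
  realcompact : IsRealcompact Y
  isEmbedding : IsEmbedding i
  denseRange : DenseRange i
  extend : ∀ f : C(X, ℝ), ∃ F : C(Y, ℝ), ∀ x, F (i x) = f x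

/-- A co-zero set. -/
def IsCozeroSet {X : Type u} [TopologicalSpace X] (U : Set X) : Prop :=
  ∃ f : C(X, ℝ), U = {x | f x ≠ 0}

/-- A paratopological group `G` is simply `sm`-factorizable if for each co-zero set `U` in `G` there
is a continuous homomorphism `π` of `G` onto a separable metrizable paratopological group `H`
with `π⁻¹(π(U)) = U`. (Such an `H` is an image of `G`, so it may be taken in the universe of `G`.) -/
def IsSimplySmFactorizable (G : Type u) [Group G] [TopologicalSpace G] : Prop :=
  ∀ U : Set G, IsCozeroSet U →
    ∃ (H : Type u) (_ : Group H) (_ : TopologicalSpace H) (π : G →* H),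
      ContinuousMul H ∧ TopologicalSpace.SeparableSpace H ∧ TopologicalSpace.MetrizableSpace H ∧
        Continuous π ∧ Function.Surjective π ∧ π ⁻¹' (π '' U) = U

/-- A paratopological group is strongly submetrizable if it admits a coarser separable metrizable
paratopological group topology. -/
def IsStronglySubmetrizable (G : Type u) [Group G] [t : TopologicalSpace G] : Prop :=
  ∃ s : TopologicalSpace G, t ≤ s ∧ @ContinuousMul G s _ ∧
    @TopologicalSpace.SeparableSpace G s ∧ @TopologicalSpace.MetrizableSpace G s

/-- The `G_δ`-closure of `Y` in `X`: the points all of whose `G_δ`-neighbourhoods (the `G_δ`-sets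
containing them) meet `Y`. -/
def gdeltaClosure {X : Type u} [TopologicalSpace X] (Y : Set X) : Set X :=
  {x | ∀ S : Set X, IsGδ S → x ∈ S → (S ∩ Y).Nonempty}

/-!
Fix a continuous function `f : G → ℝ`. Applying `sm`-factorizability to the sets `{f > q}`, `q ∈ ℚ`,
yields a continuous homomorphism from `G` to a second countable metrizable group through which `f`
factors, with kernel `N` say. The quotient `G / N` need not be regular, but its completely regular
modification `H f` is still a paratopological group, by a Urysohn lemma in the spirit of Banakh and
Ravsky that needs no separation axiom, and `f` factors through the strongly submetrizable `H f`.

Countably many continuous functions separate the points of `H f`, so `G → H f` extends to a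
continuous map `υG → H f` that takes no new values. The diagonal of these extensions embeds `υG`
in `∏ H f`. A point of the product lies in the image of `υG` if and only if on every finite set of
coordinates it agrees with some element of `G`, and equivalently if and only if it lies in the
`G_δ`-closure of `G`. The first description shows that the image is a subgroup.
-/

section ParatopologicalGroup

open scoped Pointwise

variable {G : Type*} [Group G] [TopologicalSpace G] [ContinuousMul G]

theorem closure_subset_interior_closure_mul (A : Set G) {V : Set G} (hV : V ∈ 𝓝 (1 : G)) :
    closure A ⊆ interior (closure (A * V)) := by
  have hsub : closure A * interior V ⊆ closure (A * V) :=
    (Set.mul_subset_mul_left (interior_subset.trans subset_closure)).trans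
      (smul_set_closure_subset A V)
  intro x hx
  refine interior_maximal hsub isOpen_interior.mul_left ?_
  simpa only [mul_one] using Set.mul_mem_mul hx (mem_interior_iff_mem_nhds.2 hV)

/-- The regular open sets `interior (closure (A * V))`, for `V` a neighbourhood of `1`, replace the
normality used in Urysohn's lemma: if `W * W ⊆ V`, then `interior (closure (A * W))` lies between
`A` and `interior (closure (A * V))`. -/
theorem exists_continuous_zero_one_interior_closure_mul (A : Set G) {V : Set G}
    (hV : V ∈ 𝓝 (1 : G)) :
    ∃ f : C(G, unitInterval), Set.EqOn f 0 A ∧ Set.EqOn f 1 (interior (closure (A * V)))ᶜ := by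
  let P (c u : Set G) : Prop := ∃ V ∈ 𝓝 (1 : G), interior (closure (c * V)) ⊆ u
  have closure_subset_of_P {c u : Set G} : P c u → closure c ⊆ u := fun ⟨V, hV, h⟩ =>
    (closure_subset_interior_closure_mul c hV).trans h
  have closure_closure_mul (B W : Set G) : closure (closure B * W) ⊆ closure (B * W) :=
    closure_minimal ((Set.mul_subset_mul_left subset_closure).trans
      (smul_set_closure_subset B W)) isClosed_closure
  have interpolate {c u : Set G} (hcu : P c u) :
      ∃ v, IsOpen v ∧ P c v ∧ P (closure v) u := by
    obtain ⟨V, hV, hcV⟩ := hcu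
    obtain ⟨W, hWo, hW1, hWV⟩ := exists_open_nhds_one_mul_subset hV
    have hW := hWo.mem_nhds hW1
    refine ⟨interior (closure (c * W)), isOpen_interior, ⟨W, hW, subset_rfl⟩, W, hW,
      subset_trans (interior_mono ?_) hcV⟩
    calc closure (closure (interior (closure (c * W))) * W)
        ⊆ closure (closure (c * W) * W) := closure_mono (Set.mul_subset_mul_right
          (closure_minimal interior_subset isClosed_closure))
      _ ⊆ closure (c * W * W) := closure_closure_mul _ _
      _ ⊆ closure (c * V) := closure_mono (by
          rw [mul_assoc]; exact Set.mul_subset_mul_left hWV)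
  let c : Urysohns.CU P :=
    { C := closure A
      U := interior (closure (A * V))
      P_C_U := ⟨V, hV, interior_mono (closure_closure_mul A V)⟩
      closed_C := isClosed_closure
      open_U := isOpen_interior
      subset := closure_subset_interior_closure_mul A hV
      hP := fun _ hcu _ _ =>
        let ⟨v, hv, hcv, hvu⟩ := interpolate hcu
        ⟨v, hv, subset_closure.trans (closure_subset_of_P hcv),
          subset_closure.trans (closure_subset_of_P hvu), hcv, hvu⟩ }
  exact ⟨⟨fun x => ⟨c.lim x, c.lim_mem_Icc x⟩, c.continuous_lim.subtype_mk _⟩,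
    fun x hx => Subtype.ext (c.lim_of_mem_C x (subset_closure hx)),
    fun x hx => Subtype.ext (c.lim_of_notMem_U x hx)⟩

theorem exists_continuous_zero_one_interior_closure {x : G} {U : Set G} (hU : U ∈ 𝓝 x) :
    ∃ f : C(G, unitInterval), f x = 0 ∧ Set.EqOn f 1 (interior (closure U))ᶜ := by
  have hV : (x * ·) ⁻¹' U ∈ 𝓝 (1 : G) :=
    (continuous_const_mul x).continuousAt.preimage_mem_nhds (by simpa only [mul_one] using hU)
  obtain ⟨f, hf0, hf1⟩ := exists_continuous_zero_one_interior_closure_mul {x} hV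
  refine ⟨f, hf0 rfl, hf1.mono (Set.compl_subset_compl.2 (interior_mono (closure_mono ?_)))⟩
  rw [Set.singleton_mul]
  exact Set.image_preimage_subset _ _

theorem completelyRegularSpace_of_continuousMul [RegularSpace G] : CompletelyRegularSpace G := by
  refine completelyRegularSpace_iff_isOpen.2 fun x U hU hx => ?_
  obtain ⟨C, hCx, hC, hCU⟩ := exists_mem_nhds_isClosed_subset (hU.mem_nhds hx)
  obtain ⟨f, hf0, hf1⟩ := exists_continuous_zero_one_interior_closure hCx
  refine ⟨f, f.continuous, hf0, hf1.mono (Set.compl_subset_compl.2 ?_)⟩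
  rw [hC.closure_eq]
  exact interior_subset.trans hCU

theorem t35Space_of_continuousMul [T3Space G] : T35Space G where
  toCompletelyRegularSpace := completelyRegularSpace_of_continuousMul

theorem continuousMul_quotient (N : Subgroup G) [N.Normal] : ContinuousMul (G ⧸ N) where
  continuous_mul := by
    rw [← (QuotientGroup.isOpenQuotientMap_mk.prodMap
      QuotientGroup.isOpenQuotientMap_mk).continuous_comp_iff]
    exact QuotientGroup.continuous_mk.comp continuous_mul

end ParatopologicalGroup

section RealEval

variable {X : Type*} [TopologicalSpace X]

theorem continuous_realEval : Continuous (realEval X) :=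
  continuous_pi fun f => f.continuous

theorem isInducing_realEval [CompletelyRegularSpace X] : IsInducing (realEval X) := by
  refine isInducing_iff_nhds.2 fun x => le_antisymm
    (continuous_realEval.tendsto x).le_comap fun s hs => ?_
  obtain ⟨f, hf, hf0, hf1⟩ := CompletelyRegularSpace.completely_regular_isOpen x (interior s)
    isOpen_interior (mem_interior_iff_mem_nhds.2 hs)
  let F : C(X, ℝ) := ⟨fun y => f y, by fun_prop⟩
  refine ⟨{p | p F < 1}, (isOpen_lt (continuous_apply F) continuous_const).mem_nhds ?_,
    fun y (hy : (f y : ℝ) < 1) => ?_⟩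
  · simp [realEval, F, hf0]
  · by_contra hys
    simp [hf1 fun h => hys (interior_subset h)] at hy

theorem isEmbedding_realEval [T35Space X] : IsEmbedding (realEval X) :=
  isInducing_realEval.isEmbedding

end RealEval

/-- The completely regular modification of a space `X`: the set `X` with the coarsest topology for
which all real-valued functions that are continuous on `X` remain continuous. The topology is an
instance, so the modification is a type synonym of `X`. -/
def CompletelyRegularization (X : Type*) [TopologicalSpace X] := X

namespace CompletelyRegularization

section Space

variable (X : Type*) [TopologicalSpace X]

/-- The identity map from `X` to its completely regular modification. -/
def of : X ≃ CompletelyRegularization X := Equiv.refl X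

instance instTopologicalSpace : TopologicalSpace (CompletelyRegularization X) :=
  .induced (realEval X ∘ (of X).symm) inferInstance

theorem isInducing : IsInducing (realEval X ∘ (of X).symm) := ⟨rfl⟩

instance instCompletelyRegularSpace : CompletelyRegularSpace (CompletelyRegularization X) :=
  (isInducing X).completelyRegularSpace

theorem continuous_of : Continuous (of X) :=
  (isInducing X).continuous_iff.2 continuous_realEval

variable {X}

theorem continuous_of_comp_of {Y : Type*} [TopologicalSpace Y] [CompletelyRegularSpace Y]
    {f : CompletelyRegularization X → Y} (hf : Continuous (f ∘ of X)) : Continuous f :=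
  isInducing_realEval.continuous_iff.2 <| continuous_pi fun ψ =>
    (continuous_apply (⟨ψ ∘ f ∘ of X, ψ.continuous.comp hf⟩ : C(X, ℝ))).comp
      (isInducing X).continuous

theorem t35Space_of_injective {Y : Type*} [TopologicalSpace Y] [T35Space Y] {f : X → Y}
    (hf : Continuous f) (hinj : Function.Injective f) : T35Space (CompletelyRegularization X) :=
  have : T2Space (CompletelyRegularization X) :=
    .of_injective_continuous (hinj.comp (of X).symm.injective) (continuous_of_comp_of hf)
  {}

end Space

variable {G : Type*} [Group G] [TopologicalSpace G]

instance instGroup : Group (CompletelyRegularization G) := inferInstanceAs (Group G)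

variable (G) in
/-- The identity map from a group to its completely regular modification, as an isomorphism. -/
def ofMulEquiv : G ≃* CompletelyRegularization G where
  __ := of G
  map_mul' _ _ := rfl

variable [ContinuousMul G]

theorem interior_closure_mem_nhds {x : G} {U : Set G} (hU : U ∈ 𝓝 x) :
    (of G).symm ⁻¹' interior (closure U) ∈ 𝓝 (of G x) := by
  obtain ⟨f, hf0, hf1⟩ := exists_continuous_zero_one_interior_closure hU
  have hf : Continuous (f ∘ (of G).symm) := continuous_of_comp_of f.continuous
  refine Filter.mem_of_superset ((isOpen_compl_singleton (x := 1)).preimage hf |>.mem_nhds ?_)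
    fun y hy => ?_
  · simp [hf0]
  · by_contra hyU
    exact hy (hf1 hyU)

instance instContinuousMul : ContinuousMul (CompletelyRegularization G) where
  continuous_mul := by
    refine continuous_iff_continuousAt.2 fun ⟨x, y⟩ =>
      (closed_nhds_basis _).tendsto_right_iff.2 fun C ⟨hCxy, hC⟩ => ?_
    have hmem : (fun p : G × G => of G (p.1 * p.2)) ⁻¹' C ∈ 𝓝 ((of G).symm x, (of G).symm y) :=
      ((continuous_of G).comp continuous_mul).continuousAt.preimage_mem_nhds hCxy
    obtain ⟨A, hA, B, hB, hAB⟩ := mem_nhds_prod_iff.1 hmem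
    have hclosure : closure A ×ˢ closure B ⊆ (fun p : G × G => of G (p.1 * p.2)) ⁻¹' C := by
      rw [← closure_prod_eq]
      exact closure_minimal hAB (hC.preimage ((continuous_of G).comp continuous_mul))
    have hA' := interior_closure_mem_nhds hA
    have hB' := interior_closure_mem_nhds hB
    filter_upwards [prod_mem_nhds hA' hB'] with p hp
    exact hclosure ⟨interior_subset hp.1, interior_subset hp.2⟩

end CompletelyRegularization

namespace HewittNachbin

variable {X : Type u} [TopologicalSpace X]

theorem isEmbedding_val : IsEmbedding fun p : HewittNachbin X => p.1 := .subtypeVal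

instance instT35Space : T35Space (HewittNachbin X) := isEmbedding_val.t35Space

theorem continuous_unit : Continuous (unit X) := continuous_realEval.subtype_mk _

theorem denseRange_unit : DenseRange (unit X) := by
  intro p
  rw [isEmbedding_val.closure_eq_preimage_closure_image, Set.mem_preimage, ← Set.range_comp]
  exact p.2

theorem continuousMap_ext {Y : Type*} [TopologicalSpace Y] [T2Space Y]
    {F F' : C(HewittNachbin X, Y)} (h : ∀ x, F (unit X x) = F' (unit X x)) : F = F' :=
  DFunLike.coe_injective (denseRange_unit.equalizer F.continuous F'.continuous (funext h))

/-- The continuous extension to `υX` of a continuous real-valued function on `X`. -/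
def extend (f : C(X, ℝ)) : C(HewittNachbin X, ℝ) :=
  ⟨fun p => p.1 f, (continuous_apply f).comp continuous_subtype_val⟩

theorem extend_comp_unit (F : C(HewittNachbin X, ℝ)) :
    extend (F.comp ⟨unit X, continuous_unit⟩) = F :=
  continuousMap_ext fun _ => rfl

theorem isRealcompactification_unit [T35Space X] : IsRealcompactification (unit X) where
  realcompact := ⟨C(X, ℝ), Subtype.val, isClosed_closure.isClosedEmbedding_subtypeVal⟩
  isEmbedding := .of_comp continuous_unit continuous_subtype_val isEmbedding_realEval
  denseRange := denseRange_unit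
  extend f := ⟨extend f, fun _ => rfl⟩

/-- Otherwise the reciprocal of the distance from `F` to `F p` is continuous on `X`, and its
extension to `υX` would have to be infinite at `p`. -/
theorem exists_map_unit_eq {Z : Type*} [TopologicalSpace Z] [TopologicalSpace.MetrizableSpace Z]
    (F : C(HewittNachbin X, Z)) (p : HewittNachbin X) : ∃ x, F (unit X x) = F p := by
  let := TopologicalSpace.metrizableSpaceMetric Z
  by_contra! hne
  let d : C(HewittNachbin X, ℝ) := ⟨fun q => dist (F q) (F p), by fun_prop⟩
  have hd (x : X) : d (unit X x) ≠ 0 := dist_ne_zero.2 (hne x)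
  let k : C(X, ℝ) := ⟨fun x => (d (unit X x))⁻¹, (d.continuous.comp continuous_unit).inv₀ hd⟩
  have hdk : d * extend k = 1 := continuousMap_ext fun x => mul_inv_cancel₀ (hd x)
  simpa [d] using congr($hdk p)

theorem exists_continuousMap_extension {Y : Type*} [TopologicalSpace Y] [CompletelyRegularSpace Y]
    {φ : Y → ℕ → ℝ} (hφ : Continuous φ) (hinj : Function.Injective φ) {π : X → Y}
    (hπ : Continuous π) : ∃ π' : C(HewittNachbin X, Y), ∀ x, π' (unit X x) = π x := by
  let Φ : C(HewittNachbin X, ℕ → ℝ) :=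
    .pi fun n => extend ⟨fun x => φ (π x) n, by fun_prop⟩
  -- The extension sends `p` to `π x` for any `x` with `φ (π x) = Φ p`.
  choose s hs using exists_map_unit_eq Φ
  have comp_s (ψ : C(Y, ℝ)) (p : HewittNachbin X) :
      ψ (π (s p)) = extend (ψ.comp ⟨π, hπ⟩) p := by
    obtain ⟨x, hx⟩ := exists_map_unit_eq (Φ.prodMk (extend (ψ.comp ⟨π, hπ⟩))) p
    obtain ⟨hx1, hx2⟩ := Prod.ext_iff.1 hx
    have hsx : π (s p) = π x := hinj ((hs p).trans hx1.symm)
    exact hsx ▸ hx2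
  refine ⟨⟨fun p => π (s p), isInducing_realEval.continuous_iff.2 (continuous_pi fun ψ => ?_)⟩,
    fun x => hinj (hs (unit X x))⟩
  exact (extend (ψ.comp ⟨π, hπ⟩)).continuous.congr fun p => (comp_s ψ p).symm

theorem gdeltaClosure_range_unit : gdeltaClosure (Set.range (unit X)) = Set.univ := by
  refine Set.eq_univ_of_forall fun p => ?_
  rintro _ ⟨T, hTo, hT, rfl⟩ hp
  have := hT.to_subtype
  choose f hf hf0 hf1 using fun U : T =>
    CompletelyRegularSpace.completely_regular_isOpen p U (hTo U U.2) (hp U U.2)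
  obtain ⟨x, hx⟩ := exists_map_unit_eq (.pi fun U => ⟨f U, hf U⟩ : C(_, T → unitInterval)) p
  refine ⟨unit X x, fun U hU => ?_, x, rfl⟩
  by_contra hxU
  have h01 : (1 : unitInterval) = 0 :=
    (hf1 ⟨U, hU⟩ hxU).symm.trans ((congrFun hx ⟨U, hU⟩).trans (hf0 _))
  exact one_ne_zero h01

end HewittNachbin

theorem map_mem_gdeltaClosure {X Y : Type*} [TopologicalSpace X] [TopologicalSpace Y] {f : X → Y}
    (hf : Continuous f) {A : Set X} {x : X} (hx : x ∈ gdeltaClosure A) :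
    f x ∈ gdeltaClosure (f '' A) := by
  intro S hS hxS
  obtain ⟨a, haS, haA⟩ := hx _ (hS.preimage hf) hxS
  exact ⟨f a, haS, a, haA, rfl⟩

theorem exists_forall_mem_eq_of_mem_gdeltaClosure {A : Type*} {Y : A → Type*}
    [∀ a, TopologicalSpace (Y a)] (hY : ∀ a (y : Y a), IsGδ {y}) {B : Set (∀ a, Y a)}
    {y : ∀ a, Y a} (hy : y ∈ gdeltaClosure B) {s : Set A} (hs : s.Countable) :
    ∃ b ∈ B, ∀ a ∈ s, b a = y a := by
  obtain ⟨b, hb, hbB⟩ := hy (⋂ a ∈ s, (fun z => z a) ⁻¹' {y a})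
    (.biInter hs fun a _ => (hY a (y a)).preimage (continuous_apply a)) (by simp)
  exact ⟨b, hbB, by simpa using hb⟩

/-- The elements of a product of groups that agree with an element of the image of `G` on each
finite set of coordinates, that is, the closure of the image of `G` in the product of the discrete
groups `H a`. -/
def finiteAgreement {G A : Type*} {H : A → Type*} [Group G] [∀ a, Group (H a)]
    (π : ∀ a, G →* H a) : Subgroup (∀ a, H a) where
  carrier := {y | ∀ s : Finset A, ∃ g, ∀ a ∈ s, π a g = y a}
  one_mem' _ := ⟨1, fun a _ => map_one (π a)⟩
  mul_mem' {x y} hx hy s := by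
    obtain ⟨g, hg⟩ := hx s
    obtain ⟨h, hh⟩ := hy s
    exact ⟨g * h, fun a ha => by simp [hg a ha, hh a ha]⟩
  inv_mem' {x} hx s := by
    obtain ⟨g, hg⟩ := hx s
    exact ⟨g⁻¹, fun a ha => by simp [hg a ha]⟩

namespace HewittNachbin

section Product

variable {X : Type u} [TopologicalSpace X] {Y : C(X, ℝ) → Type u} [∀ f, TopologicalSpace (Y f)]
  {j : ∀ f, C(HewittNachbin X, Y f)} {F : ∀ f, C(Y f, ℝ)}

theorem isEmbedding_pi (hF : ∀ f, (F f).comp (j f) = extend f) :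
    IsEmbedding fun p f => j f p := by
  have hval : Continuous fun (y : ∀ f, Y f) f => F f (y f) := by fun_prop
  have hcomp : (fun (y : ∀ f, Y f) f => F f (y f)) ∘ (fun p f => j f p) = Subtype.val :=
    funext fun p => funext fun f => congr($(hF f) p)
  exact .of_comp (by fun_prop) hval (hcomp ▸ .subtypeVal)

theorem mem_range_pi_of_forall_finset [∀ f, T35Space (Y f)]
    (hF : ∀ f, (F f).comp (j f) = extend f) {y : ∀ f, Y f}
    (hy : ∀ s : Finset C(X, ℝ), ∃ x, ∀ f ∈ s, j f (unit X x) = y f) :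
    y ∈ Set.range fun p f => j f p := by
  classical
  have F_eq {f : C(X, ℝ)} {x : X} (hx : j f (unit X x) = y f) : F f (y f) = f x := by
    rw [← hx]
    exact congr($(hF f) (unit X x))
  have hmem : (fun f => F f (y f)) ∈ closure (Set.range (realEval X)) := by
    refine mem_closure_iff.2 fun U hU hyU => ?_
    obtain ⟨I, u, hu, hI⟩ := isOpen_pi_iff.1 hU _ hyU
    obtain ⟨x, hx⟩ := hy I
    refine ⟨realEval X x, hI fun f hf => ?_, Set.mem_range_self x⟩
    simpa only [realEval, F_eq (hx f hf)] using (hu f hf).2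
  -- Each `ψ ∘ j f` is the extension of a function `g` that is itself an index of the product.
  refine ⟨⟨_, hmem⟩, funext fun f => isEmbedding_realEval.injective (funext fun ψ => ?_)⟩
  let g : C(X, ℝ) := (ψ.comp (j f)).comp ⟨unit X, continuous_unit⟩
  have hg : extend g = ψ.comp (j f) := extend_comp_unit _
  obtain ⟨x, hx⟩ := hy {f, g}
  calc ψ (j f ⟨_, hmem⟩) = F g (y g) := congr($hg.symm ⟨_, hmem⟩)
    _ = g x := F_eq (hx g (by simp))
    _ = ψ (y f) := congrArg ψ (hx f (by simp))

theorem range_pi_subset_gdeltaClosure (j : ∀ f, C(HewittNachbin X, Y f)) :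
    (Set.range fun p f => j f p) ⊆ gdeltaClosure (Set.range fun x f => j f (unit X x)) := by
  rintro _ ⟨p, rfl⟩
  have hp : p ∈ gdeltaClosure (Set.range (unit X)) :=
    gdeltaClosure_range_unit.ge (Set.mem_univ p)
  have hj : Continuous fun p f => j f p := by fun_prop
  simpa only [← Set.range_comp, Function.comp_def] using map_mem_gdeltaClosure hj hp

theorem range_pi_eq_gdeltaClosure [∀ f, T35Space (Y f)] (hY : ∀ f (y : Y f), IsGδ {y})
    (hF : ∀ f, (F f).comp (j f) = extend f) :
    (Set.range fun p f => j f p) = gdeltaClosure (Set.range fun x f => j f (unit X x)) := by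
  refine (range_pi_subset_gdeltaClosure j).antisymm fun y hy =>
    mem_range_pi_of_forall_finset hF fun s => ?_
  simpa using exists_forall_mem_eq_of_mem_gdeltaClosure hY hy s.countable_toSet

theorem range_pi_eq_finiteAgreement {G : Type u} [Group G] [TopologicalSpace G]
    {H : C(G, ℝ) → Type u} [∀ f, Group (H f)] [∀ f, TopologicalSpace (H f)] [∀ f, T35Space (H f)]
    (hH : ∀ f (y : H f), IsGδ {y}) {π : ∀ f, G →* H f} {j : ∀ f, C(HewittNachbin G, H f)}
    (hj : ∀ f x, j f (unit G x) = π f x) {F : ∀ f, C(H f, ℝ)}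
    (hF : ∀ f, (F f).comp (j f) = extend f) :
    (Set.range fun p f => j f p) = finiteAgreement π := by
  refine Set.Subset.antisymm (fun y hy s => ?_) fun y hy =>
    mem_range_pi_of_forall_finset hF fun s => by simpa only [hj] using hy s
  simpa [hj] using exists_forall_mem_eq_of_mem_gdeltaClosure hH
    (range_pi_subset_gdeltaClosure j hy) s.countable_toSet

end Product

end HewittNachbin

section SecondCountable

variable {X : Type*} [TopologicalSpace X] [TopologicalSpace.SeparableSpace X]
  [TopologicalSpace.MetrizableSpace X]

variable (X) in
theorem secondCountableTopology_of_separableSpace_of_metrizableSpace :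
    SecondCountableTopology X := by
  let := TopologicalSpace.metrizableSpaceMetric X
  exact UniformSpace.secondCountable_of_separable X

variable (X) in
theorem exists_continuous_injective_nat_real :
    ∃ φ : X → ℕ → ℝ, Continuous φ ∧ Function.Injective φ := by
  have := secondCountableTopology_of_separableSpace_of_metrizableSpace X
  obtain ⟨φ, hφ⟩ := TopologicalSpace.exists_embedding_l_infty X
  exact ⟨fun x => φ x, BoundedContinuousFunction.continuous_coe.comp hφ.continuous,
    DFunLike.coe_injective.comp hφ.injective⟩

end SecondCountable

namespace IsStronglySubmetrizable

variable {H : Type u} [Group H] [TopologicalSpace H]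

theorem exists_continuous_injective_nat_real (hH : IsStronglySubmetrizable H) :
    ∃ φ : H → ℕ → ℝ, Continuous φ ∧ Function.Injective φ := by
  obtain ⟨s, hs, -, hsep, hmet⟩ := hH
  obtain ⟨φ, hφ, hinj⟩ := @_root_.exists_continuous_injective_nat_real H s hsep hmet
  exact ⟨φ, continuous_le_dom hs hφ, hinj⟩

theorem isGδ_singleton (hH : IsStronglySubmetrizable H) (x : H) : IsGδ {x} := by
  obtain ⟨φ, hφ, hinj⟩ := hH.exists_continuous_injective_nat_real
  simpa only [← Set.image_singleton, hinj.preimage_image] using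
    (IsGδ.singleton (φ x)).preimage hφ

theorem of_injective {K : Type*} [Group K] [TopologicalSpace K] [ContinuousMul K]
    [SecondCountableTopology K] [TopologicalSpace.MetrizableSpace K] {Ψ : H →* K}
    (hΨ : Continuous Ψ) (hinj : Function.Injective Ψ) : IsStronglySubmetrizable H := by
  refine ⟨.induced Ψ inferInstance, hΨ.le_induced, continuousMul_induced Ψ, ?_, ?_⟩
  all_goals let := TopologicalSpace.induced Ψ inferInstance
  · have := TopologicalSpace.secondCountableTopology_induced H K Ψ
    infer_instance
  · have hemb : IsEmbedding Ψ := ⟨⟨rfl⟩, hinj⟩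
    exact hemb.metrizableSpace

end IsStronglySubmetrizable

theorem isCozeroSet_setOf_lt {X : Type u} [TopologicalSpace X] (f : C(X, ℝ)) (c : ℝ) :
    IsCozeroSet {x | c < f x} :=
  ⟨⟨fun x => max (f x - c) 0, by fun_prop⟩, Set.ext fun x => by simp⟩

namespace IsSimplySmFactorizable

variable {G : Type u} [Group G] [TopologicalSpace G]

theorem exists_factorsThrough (hG : IsSimplySmFactorizable G) (f : C(G, ℝ)) :
    ∃ (K : Type u) (_ : Group K) (_ : TopologicalSpace K) (Φ : G →* K),
      ContinuousMul K ∧ SecondCountableTopology K ∧ TopologicalSpace.MetrizableSpace K ∧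
        Continuous Φ ∧ Function.FactorsThrough f Φ := by
  choose K _ _ ρ _ _ _ hρc _ hρ using fun q : ℚ => hG _ (isCozeroSet_setOf_lt f q)
  have (q : ℚ) := secondCountableTopology_of_separableSpace_of_metrizableSpace (K q)
  refine ⟨∀ q, K q, inferInstance, inferInstance, MonoidHom.pi ρ, inferInstance, inferInstance,
    TopologicalSpace.metrizableSpace_of_t3_secondCountable _, continuous_pi hρc,
    fun x y hxy => eq_of_forall_rat_lt_iff_lt fun q => ?_⟩
  have hxyq : ρ q x = ρ q y := congrFun hxy q
  have mem_iff (z : G) : (q : ℝ) < f z ↔ ρ q z ∈ ρ q '' {z | (q : ℝ) < f z} :=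
    (Set.ext_iff.1 (hρ q) z).symm
  rw [mem_iff x, mem_iff y, hxyq]

theorem exists_factorization [ContinuousMul G] (hG : IsSimplySmFactorizable G) (f : C(G, ℝ)) :
    ∃ (H : Type u) (_ : Group H) (_ : TopologicalSpace H) (π : G →* H) (F : C(H, ℝ)),
      ContinuousMul H ∧ T35Space H ∧ IsStronglySubmetrizable H ∧
        Continuous π ∧ Function.Surjective π ∧ ∀ x, F (π x) = f x := by
  obtain ⟨K, _, _, Φ, _, _, _, hΦ, hf⟩ := hG.exists_factorsThrough f
  let Q := G ⧸ Φ.ker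
  have : ContinuousMul Q := continuousMul_quotient Φ.ker
  have hΨ : Continuous (QuotientGroup.kerLift Φ) := continuous_quot_lift _ hΦ
  have hΨinj := QuotientGroup.kerLift_injective Φ
  let F : Q → ℝ := Function.extend Φ f 0 ∘ QuotientGroup.kerLift Φ
  have hF (x : G) : F x = f x := hf.extend_apply 0 x
  have hFc : Continuous F :=
    QuotientGroup.isOpenQuotientMap_mk.continuous_comp_iff.1
      (f.continuous.congr fun x => (hF x).symm)
  let e : CompletelyRegularization Q ≃* Q := (CompletelyRegularization.ofMulEquiv Q).symm
  exact ⟨CompletelyRegularization Q, inferInstance, inferInstance,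
    e.symm.toMonoidHom.comp (QuotientGroup.mk' Φ.ker),
    ⟨F ∘ e, CompletelyRegularization.continuous_of_comp_of hFc⟩, inferInstance,
    CompletelyRegularization.t35Space_of_injective hΨ hΨinj,
    .of_injective (Ψ := (QuotientGroup.kerLift Φ).comp e.toMonoidHom)
      (CompletelyRegularization.continuous_of_comp_of hΨ) (hΨinj.comp e.injective),
    (CompletelyRegularization.continuous_of Q).comp QuotientGroup.continuous_mk,
    e.symm.surjective.comp (QuotientGroup.mk'_surjective Φ.ker), hF⟩

theorem of_forall_factorsThrough
    (h : ∀ f : C(G, ℝ), ∃ (H : Type u) (_ : Group H) (_ : TopologicalSpace H) (π : G →* H),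
      IsStronglySubmetrizable H ∧ Continuous π ∧ Function.Surjective π ∧
        Function.FactorsThrough f π) :
    IsSimplySmFactorizable G := by
  rintro _ ⟨f, rfl⟩
  obtain ⟨H, _, _, π, ⟨s, hs, hmul, hsep, hmet⟩, hπ, hsurj, hf⟩ := h f
  refine ⟨H, _, s, π, hmul, hsep, hmet, continuous_le_rng hs hπ, hsurj,
    Set.Subset.antisymm ?_ (Set.subset_preimage_image _ _)⟩
  rintro x ⟨y, hy, hyx⟩
  exact fun hx => hy ((hf hyx).trans hx)

end IsSimplySmFactorizable

theorem group_eq_of_denseRange {X Y : Type*} [Mul X] [TopologicalSpace Y] [T2Space Y] {i : X → Y}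
    (hi : DenseRange i) {g₁ g₂ : Group Y} (h₁ : @ContinuousMul Y _ g₁.toMul)
    (h₂ : @ContinuousMul Y _ g₂.toMul) (hi₁ : ∀ x y, i (x * y) = g₁.mul (i x) (i y))
    (hi₂ : ∀ x y, i (x * y) = g₂.mul (i x) (i y)) : g₁ = g₂ := by
  refine Group.ext (funext₂ fun x y => ?_)
  have heq := (hi.prodMap hi).equalizer (@continuous_mul Y _ g₁.toMul h₁)
    (@continuous_mul Y _ g₂.toMul h₂) (funext fun z => (hi₁ z.1 z.2).symm.trans (hi₂ z.1 z.2))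
  exact congrFun heq (x, y)

theorem exists_group_monoidHom_coe_eq {Y P : Type*} [Group P] {S : Subgroup P} {j : Y → P}
    (hj : Function.Injective j) (hS : Set.range j = S) :
    ∃ (_ : Group Y) (J : Y →* P), ⇑J = j := by
  let e : Y ≃ S := (Equiv.ofInjective j hj).trans (Equiv.setCongr hS)
  let grp : Group Y := e.group
  exact ⟨grp, S.subtype.comp e.mulEquiv.toMonoidHom, rfl⟩

theorem IsSimplySmFactorizable.exists_isEmbedding_pi {G : Type u} [Group G] [TopologicalSpace G]
    [ContinuousMul G] (hG : IsSimplySmFactorizable G) :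
    ∃ (_ : Group (HewittNachbin G)) (H : C(G, ℝ) → Type u) (_ : ∀ f, Group (H f))
      (_ : ∀ f, TopologicalSpace (H f)) (j : HewittNachbin G →* ∀ f, H f) (F : ∀ f, C(H f, ℝ)),
      (∀ f, ContinuousMul (H f) ∧ T3Space (H f) ∧ IsStronglySubmetrizable (H f)) ∧
      (∀ x y : G, HewittNachbin.unit G (x * y) = HewittNachbin.unit G x * HewittNachbin.unit G y) ∧
      (∀ f, Function.Surjective fun x : G => j (HewittNachbin.unit G x) f) ∧
      (∀ f p, F f (j p f) = HewittNachbin.extend f p) ∧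
      IsEmbedding j ∧
      Set.range j = gdeltaClosure (Set.range fun x : G => j (HewittNachbin.unit G x)) := by
  choose H _ _ π F _ _ hH hπ hπs hFπ using hG.exists_factorization
  choose φ hφ hinj using fun f => (hH f).exists_continuous_injective_nat_real
  choose j hj using fun f =>
    HewittNachbin.exists_continuousMap_extension (hφ f) (hinj f) (hπ f)
  have hF (f : C(G, ℝ)) : (F f).comp (j f) = HewittNachbin.extend f :=
    HewittNachbin.continuousMap_ext fun x => (congrArg (F f) (hj f x)).trans (hFπ f x)
  have hGδ (f : C(G, ℝ)) (y : H f) : IsGδ {y} := (hH f).isGδ_singleton y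
  have hemb := HewittNachbin.isEmbedding_pi hF
  obtain ⟨grp, J, hJ⟩ := exists_group_monoidHom_coe_eq hemb.injective
    (HewittNachbin.range_pi_eq_finiteAgreement hGδ hj hF)
  rw [← hJ] at hemb
  have hJunit (x f) : J (HewittNachbin.unit G x) f = π f x := by simp only [hJ, hj]
  refine ⟨grp, H, _, _, J, F, fun f => ⟨inferInstance, inferInstance, hH f⟩, fun x y => ?_,
    fun f => ?_, fun f p => ?_, hemb, ?_⟩
  · exact hemb.injective (funext fun f => by simp only [map_mul, Pi.mul_apply, hJunit])
  · simpa only [hJunit] using hπs f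
  · simpa only [hJ, ContinuousMap.comp_apply] using congr($(hF f) p)
  · rw [hJ]
    exact HewittNachbin.range_pi_eq_gdeltaClosure hGδ hF

theorem theorem4p3_general (G : Type u) [Group G] [TopologicalSpace G] [ContinuousMul G]
    (hG : IsSimplySmFactorizable G) :
    ∃ grp : Group (HewittNachbin G),
      ContinuousMul (HewittNachbin G) ∧
      (∀ x y : G, HewittNachbin.unit G (x * y) = HewittNachbin.unit G x * HewittNachbin.unit G y) ∧
      (∀ grp' : Group (HewittNachbin G),
        @ContinuousMul (HewittNachbin G) _ grp'.toMul →
        (∀ x y : G, HewittNachbin.unit G (x * y) =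
          grp'.mul (HewittNachbin.unit G x) (HewittNachbin.unit G y)) →
        grp' = grp) ∧
      IsSimplySmFactorizable (HewittNachbin G) ∧
      ∃ (A : Type u) (H : A → Type u) (_ : ∀ a, Group (H a)) (_ : ∀ a, TopologicalSpace (H a))
        (j : HewittNachbin G →* ∀ a, H a),
        (∀ a, ContinuousMul (H a) ∧ T3Space (H a) ∧ IsStronglySubmetrizable (H a)) ∧
        (∀ a, Function.Surjective fun x : G => j (HewittNachbin.unit G x) a) ∧
        IsEmbedding j ∧
        Set.range j = gdeltaClosure (Set.range fun x : G => j (HewittNachbin.unit G x)) := by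
  obtain ⟨grp, H, _, _, j, F, hH, hunit, hsurj, hF, hemb, hrange⟩ := hG.exists_isEmbedding_pi
  have (f : C(G, ℝ)) : ContinuousMul (H f) := (hH f).1
  have hmul : ContinuousMul (HewittNachbin G) := hemb.isInducing.continuousMul j
  have factors (f : C(HewittNachbin G, ℝ)) : ∃ g, ∀ p, f p = F g (j p g) :=
    ⟨f.comp ⟨_, HewittNachbin.continuous_unit⟩, fun p => by rw [hF, HewittNachbin.extend_comp_unit]⟩
  refine ⟨grp, hmul, hunit,
    fun _ h h' => group_eq_of_denseRange HewittNachbin.denseRange_unit h hmul h' hunit,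
    .of_forall_factorsThrough fun f => ?_, _, H, _, _, j, hH, hsurj, hemb, hrange⟩
  obtain ⟨g, hg⟩ := factors f
  exact ⟨H g, _, _, (Pi.evalMonoidHom H g).comp j, (hH g).2.2,
    (continuous_apply g).comp hemb.continuous, .of_comp (hsurj g),
    fun p q hpq => (hg p).trans ((congrArg (F g) hpq).trans (hg q).symm)⟩

theorem theorem4p3 (G : Type u) [Group G] [TopologicalSpace G] [ContinuousMul G] [T3Space G]
    (hG : IsSimplySmFactorizable G) :
    IsRealcompactification (HewittNachbin.unit G) ∧
    ∃ grp : Group (HewittNachbin G),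
      -- a paratopological group containing `G` as a (dense) subgroup
      ContinuousMul (HewittNachbin G) ∧
      (∀ x y : G, HewittNachbin.unit G (x * y) = HewittNachbin.unit G x * HewittNachbin.unit G y) ∧
      -- the structure is the only one with these properties
      (∀ grp' : Group (HewittNachbin G),
        @ContinuousMul (HewittNachbin G) _ grp'.toMul →
        (∀ x y : G, HewittNachbin.unit G (x * y) =
          grp'.mul (HewittNachbin.unit G x) (HewittNachbin.unit G y)) →
        grp' = grp) ∧
      IsSimplySmFactorizable (HewittNachbin G) ∧
      -- realization as a `G_δ`-closure in a product of strongly submetrizable groups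
      ∃ (A : Type u) (H : A → Type u) (_ : ∀ a, Group (H a)) (_ : ∀ a, TopologicalSpace (H a))
        (j : HewittNachbin G →* ∀ a, H a),
        (∀ a, ContinuousMul (H a) ∧ T3Space (H a) ∧ IsStronglySubmetrizable (H a)) ∧
        (∀ a, Function.Surjective fun x : G => j (HewittNachbin.unit G x) a) ∧
        IsEmbedding j ∧
        Set.range j = gdeltaClosure (Set.range fun x : G => j (HewittNachbin.unit G x)) := by
  have : T35Space G := t35Space_of_continuousMul
  exact ⟨HewittNachbin.isRealcompactification_unit, theorem4p3_general G hG⟩
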